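/- For $n\ge 0$ let $(a;q)_n=\prod_{j=0}^{n-1}(1-aq^j)$. For $n\ge 2$ let $e_n=e_n(q)$ (respectively $d_n=d_n(q)$) be the Schur polynomials: $e_n$ is the generating function $\sum_\lambda q^{|\lambda|}$ of the partitions $\lambda$ with difference between parts at least $2$ and largest part at most $n-2$, and $d_n$ is the generating function of those among these partitions that have no part equal to $1$. (i) For $k\in\{0,1\}$ and $n\ge 0$, $$\sum_{j=-n-k}^{n}(-1)^j q^{j(5j+1)/2}=\sum_{r=0}^{n} e_{2r+k+2}\,(-1)^{n-r} q^{(n-r)(5n+3r+4k+5)/2}\,\frac{(q;q)_{n+r+k}}{(q;q)_{n-r}}$$ and $$\sum_{j=-n-k}^{n}(-1)^j q^{j(5j+3)/2}=\sum_{r=0}^{n} d_{2r+k+2}\,(-1)^{n-r} q^{(n-r)(5n+3r+4k+5)/2}\,\frac{(q;q)_{n+r+k}}{(q;q)_{n-r}},$$ where $q$ is an indeterminate or, more generally, any element of a field with $(q;q)_n\neq 0$. (ii) Let $q\in\mathbb{C}$ with $|q|<1$, and put $(q;q)_\infty=\prod_{i\ge 1}(1-q^i)$. As $n\to\infty$,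 for either $k\in\{0,1\}$, the left sides of the two identities converge to $\sum_{j\in\mathbb{Z}}(-1)^jq^{j(5j+1)/2}$ and $\sum_{j\in\mathbb{Z}}(-1)^jq^{j(5j+3)/2}$, and the right sides converge to $(q;q)_\infty\sum_{m\ge 0}\frac{q^{m^2}}{(q;q)_m}$ and $(q;q)_\infty\sum_{m\ge 0}\frac{q^{m(m+1)}}{(q;q)_m}$, respectively. Moreover the Rogers–Ramanujan identities hold: $$\sum_{m=0}^{\infty}\frac{q^{m^2}}{(q;q)_m}=\prod_{j=0}^{\infty}\frac{1}{(1-q^{5j+1})(1-q^{5j+4})},\qquad \sum_{m=0}^{\infty}\frac{q^{m(m+1)}}{(q;q)_m}=\prod_{j=0}^{\infty}\frac{1}{(1-q^{5j+2})(1-q^{5j+3})},$$ all series and products being convergent. -/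

import Mathlib

open Filter Topology Polynomial

/-- The `q`-shifted factorial `(a;q)_n = ∏_{j=0}^{n-1} (1 - a q^j)`. -/
def qPoch {K : Type*} [CommRing K] (a q : K) (n : ℕ) : K :=
  ∏ j ∈ Finset.range n, (1 - a * q ^ j)

/-- The partitions with parts in `{lo, …, hi}` and difference between any two parts at least `2`.
The parts of such a partition are distinct, so the partition is given by its set of parts. -/
def gapPartitions (lo hi : ℕ) : Finset (Finset ℕ) :=
  (Finset.Icc lo hi).powerset.filter fun s => ∀ a ∈ s, ∀ b ∈ s, a < b → a + 2 ≤ b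

/-- The Schur polynomial `e_n` (meaningful for `n ≥ 2`): the generating function of partitions with
difference between parts at least `2` and largest part at most `n - 2`. -/
noncomputable def schurE (n : ℕ) : ℤ[X] :=
  ∑ s ∈ gapPartitions 1 (n - 2), X ^ (∑ a ∈ s, a)

/-- The Schur polynomial `d_n` (meaningful for `n ≥ 2`): the generating function of partitions with
difference between parts at least `2`, no part equal to `1`, and largest part at most `n - 2`. -/
noncomputable def schurD (n : ℕ) : ℤ[X] :=
  ∑ s ∈ gapPartitions 2 (n - 2), X ^ (∑ a ∈ s, a)

/-- The term `(-1)^j q^{j(5j+c)/2}` of the theta series. For odd `c` the division is exact. -/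
noncomputable def thetaTerm {K : Type*} [Field K] (c : ℤ) (q : K) (j : ℤ) : K :=
  (-1) ^ j * q ^ (j * (5 * j + c) / 2)

/-- The partial theta sum `∑_{j=-n-k}^{n} (-1)^j q^{j(5j+c)/2}`. -/
noncomputable def partialTheta {K : Type*} [Field K] (c : ℤ) (q : K) (k n : ℕ) : K :=
  ∑ j ∈ Finset.Icc (-(n : ℤ) - (k : ℤ)) (n : ℤ), thetaTerm c q j

/-- The weighted sum
`∑_{r=0}^{n} x_{2r+k+2}(q) (-1)^{n-r} q^{(n-r)(5n+3r+4k+5)/2} (q;q)_{n+r+k} / (q;q)_{n-r}`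
over a sequence `x` of polynomials. The division in the exponent is exact. -/
noncomputable def weightedSum {K : Type*} [Field K] (x : ℕ → ℤ[X]) (q : K) (k n : ℕ) : K :=
  ∑ r ∈ Finset.range (n + 1),
    aeval q (x (2 * r + k + 2)) * (-1) ^ (n - r) *
      q ^ ((n - r) * (5 * n + 3 * r + 4 * k + 5) / 2) *
      (qPoch q q (n + r + k) / qPoch q q (n - r))

/-! This is Schur's method. Both Schur families solve `x (m + 2) = x (m + 1) + q ^ m * x m`, with
starting values (0, 1) and (1, 0). With `i = n - r`, the right sides for `k = 0, 1` become one
sequence S(N), `N = 2n + k`. The termwise difference S(N+1) - S(N) telescopes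
(`sum_schurCoeff_sub`), and what remains is exactly the next theta term, of index `-n-1` or `n+1`
alternately; this gives the finite identities.

As N grows only the `i = 0` term of S(N) survives, so S(N) tends to (q;q)_∞ lim x. That limit comes
from an invariant pairing of `x` with the series `rrSeries q i`, which satisfy an adjoint recurrence
(`schurRec_mul_rrSeries`). The theta series is a product by Jacobi's triple product, obtained from a
finite form (`hasSum_finite_tripleProduct`). Cancelling the factors shared with (q;q)_∞ leaves the
Rogers–Ramanujan products. -/

/-- The solution of `x (m + 2) = x (m + 1) + q ^ m * x m` with initial values `a`, `b`. -/
def schurRec {K : Type*} [CommRing K] (q a b : K) : ℕ → K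
  | 0 => a
  | 1 => b
  | m + 2 => schurRec q a b (m + 1) + q ^ m * schurRec q a b m

/-! ### Recurrence of the Schur polynomials -/

/-- Split by whether `m + 2` is a part; if it is, the gap condition forces the others to be at most
`m`. -/
theorem gapPartitions_add_two {lo m : ℕ} (h : lo ≤ m + 2) :
    gapPartitions lo (m + 2) =
      gapPartitions lo (m + 1) ∪ (gapPartitions lo m).image (insert (m + 2)) := by
  ext s
  simp only [gapPartitions, Finset.mem_filter, Finset.mem_powerset, Finset.mem_union,
    Finset.mem_image, Finset.subset_iff, Finset.mem_Icc]
  constructor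
  · rintro ⟨h1, h2⟩
    by_cases hm : m + 2 ∈ s
    · right
      refine ⟨s.erase (m + 2), ⟨fun x hx => ?_, fun a ha b hb => ?_⟩, Finset.insert_erase hm⟩
      · rw [Finset.mem_erase] at hx
        have := h1 hx.2
        have := h2 x hx.2 (m + 2) hm (by omega)
        omega
      · exact h2 a (Finset.mem_of_mem_erase ha) b (Finset.mem_of_mem_erase hb)
    · left
      refine ⟨fun x hx => ?_, h2⟩
      have := h1 hx
      have : x ≠ m + 2 := fun h => hm (h ▸ hx)
      omega
  · rintro (⟨h1, h2⟩ | ⟨t, ⟨h1, h2⟩, rfl⟩)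
    · exact ⟨fun x hx => by have := h1 hx; omega, h2⟩
    · simp only [Finset.mem_insert]
      refine ⟨?_, ?_⟩
      · rintro x (rfl | hx)
        · omega
        · have := h1 hx; omega
      · rintro a (rfl | ha) b (rfl | hb) hab
        · omega
        · have := h1 hb; omega
        · have := h1 ha; omega
        · exact h2 a ha b hb hab

theorem sum_gapPartitions_add_two {lo m : ℕ} (h : lo ≤ m + 2) :
    ∑ s ∈ gapPartitions lo (m + 2), (X : ℤ[X]) ^ (∑ a ∈ s, a) =
      ∑ s ∈ gapPartitions lo (m + 1), X ^ (∑ a ∈ s, a) +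
        X ^ (m + 2) * ∑ s ∈ gapPartitions lo m, X ^ (∑ a ∈ s, a) := by
  have hmem : ∀ n, ∀ s ∈ gapPartitions lo n, ∀ x ∈ s, x ≤ n := by
    intro n s hs x hx
    simp only [gapPartitions, Finset.mem_filter, Finset.mem_powerset] at hs
    exact (Finset.mem_Icc.1 (hs.1 hx)).2
  have hnot : ∀ s ∈ gapPartitions lo m, m + 2 ∉ s := fun s hs hx => by
    have := hmem m s hs _ hx; omega
  rw [gapPartitions_add_two h, Finset.sum_union, Finset.sum_image, Finset.mul_sum]
  · congr 1
    refine Finset.sum_congr rfl fun s hs => ?_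
    rw [Finset.sum_insert (hnot s hs), pow_add]
  · intro s hs t ht hst
    have := congrArg (fun u => u.erase (m + 2)) hst
    simpa [Finset.erase_insert (hnot s hs), Finset.erase_insert (hnot t ht)] using this
  · rw [Finset.disjoint_left]
    intro s hs hs'
    obtain ⟨t, -, rfl⟩ := Finset.mem_image.1 hs'
    have := hmem _ _ hs _ (Finset.mem_insert_self _ _)
    omega

theorem gapPartitions_of_lt {lo hi : ℕ} (h : hi < lo) : gapPartitions lo hi = {∅} := by
  rw [gapPartitions, Finset.Icc_eq_empty (by omega)]
  rfl

/-- The values 0, 1 at indices 0, 1 come from running the recurrence backwards from e_2 = 1, e_3 = 1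
+ q. -/
theorem aeval_schurE {K : Type*} [CommRing K] (q : K) (m : ℕ) :
    aeval q (schurE (m + 2)) = schurRec q 0 1 (m + 2) := by
  induction m using Nat.strong_induction_on with
  | _ m ih =>
    match m with
    | 0 => simp [schurE, gapPartitions_of_lt, schurRec]
    | 1 =>
      have h : gapPartitions 1 1 = {∅, {1}} := by decide
      simp [schurE, h, schurRec]
    | m + 2 =>
      have h1 := ih (m + 1) (by omega)
      have h0 := ih m (by omega)
      have h := sum_gapPartitions_add_two (lo := 1) (m := m) (by omega)
      simp only [schurE, Nat.add_sub_cancel] at h0 h1 ⊢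
      rw [h, map_add, map_mul, map_pow, aeval_X, schurRec, ← h0, ← h1]

theorem aeval_schurD {K : Type*} [CommRing K] (q : K) (m : ℕ) :
    aeval q (schurD (m + 2)) = schurRec q 1 0 (m + 2) := by
  induction m using Nat.strong_induction_on with
  | _ m ih =>
    match m with
    | 0 => simp [schurD, gapPartitions_of_lt, schurRec]
    | 1 => simp [schurD, gapPartitions_of_lt, schurRec]
    | m + 2 =>
      have h1 := ih (m + 1) (by omega)
      have h0 := ih m (by omega)
      have h := sum_gapPartitions_add_two (lo := 2) (m := m) (by omega)
      simp only [schurD, Nat.add_sub_cancel] at h0 h1 ⊢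
      rw [h, map_add, map_mul, map_pow, aeval_X, schurRec, ← h0, ← h1]

theorem two_mul_choose_two_add (n : ℕ) : n.choose 2 * 2 + n = n * n := by
  rw [Nat.choose_two_right, Nat.div_mul_cancel (Nat.even_mul_pred_self n).two_dvd]
  cases n <;> simp; ring

/-! ### The finite identities by telescoping -/

section Finite

variable {K : Type*} [Field K]

theorem qPoch_succ (q : K) (n : ℕ) : qPoch q q (n + 1) = qPoch q q n * (1 - q ^ (n + 1)) := by
  rw [qPoch, Finset.prod_range_succ, pow_succ', qPoch]

theorem qPoch_ne_zero_of_le {q : K} {m n : ℕ} (h : m ≤ n) (hn : qPoch q q n ≠ 0) :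
    qPoch q q m ≠ 0 := by
  rw [qPoch, Finset.prod_ne_zero_iff] at *
  exact fun a ha => hn a (Finset.mem_range.2 ((Finset.mem_range.1 ha).trans_le h))

/-- The coefficient `(-1)^i q^{i(4N-3i+5)/2} (q;q)_{N-i} / (q;q)_i`, for `2 i ≤ N`. -/
def schurCoeff (q : K) (N i : ℕ) : K :=
  (-1) ^ i * q ^ (5 * i.choose 2 + 5 * i + 2 * i * (N - 2 * i)) * (qPoch q q (N - i) / qPoch q q i)

/-- The weighted sum of the terms of a sequence whose indices have the parity of `N`. -/
def schurSum (q : K) (x : ℕ → K) (N : ℕ) : K :=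
  ∑ i ∈ Finset.range (N / 2 + 1), schurCoeff q N i * x (N + 2 - 2 * i)

/-- Put `N = 2 * s + t`. Passing from `(s, t + 2)` to `(s + 1, t)` keeps N fixed and adds one term,
so the claim is a telescoping partial sum; `t` must stay free in the induction, though only `t = 0,
1` are needed. -/
theorem sum_schurCoeff_sub (q a b : K) (s : ℕ) : ∀ t : ℕ, qPoch q q s ≠ 0 →
    ∑ i ∈ Finset.range (s + 1),
      (schurCoeff q (2 * s + 1 + t) i * schurRec q a b (2 * s + 1 + t + 2 - 2 * i) -
        schurCoeff q (2 * s + t) i * schurRec q a b (2 * s + t + 2 - 2 * i)) =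
      (-1) ^ s * q ^ (5 * s.choose 2 + 6 * s + 2 * t * s + t + 1) *
        (qPoch q q (s + 1 + t) * schurRec q a b (t + 1) -
          qPoch q q (s + t) * schurRec q a b (t + 2)) / qPoch q q s := by
  induction s with
  | zero =>
    intro t _
    have e : 0 + 1 + t = t + 1 := by omega
    simp [schurCoeff, schurRec, qPoch_succ, e]
    simp [qPoch]
    ring
  | succ s ih =>
    intro t hs
    have hs' := qPoch_ne_zero_of_le (Nat.le_succ s) hs
    have hq : 1 - q ^ (s + 1) ≠ 0 := fun h => hs (by rw [qPoch_succ, h, mul_zero])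
    have e1 : 2 * (s + 1) + 1 + t = 2 * s + 1 + (t + 2) := by ring
    have e2 : 2 * (s + 1) + t = 2 * s + (t + 2) := by ring
    rw [Finset.sum_range_succ, e1, e2, ih (t + 2) hs']
    have e3 : 2 * s + 1 + (t + 2) + 2 - 2 * (s + 1) = t + 3 := by omega
    have e4 : 2 * s + (t + 2) + 2 - 2 * (s + 1) = t + 2 := by omega
    have e5 : 2 * s + 1 + (t + 2) - 2 * (s + 1) = t + 1 := by omega
    have e6 : 2 * s + (t + 2) - 2 * (s + 1) = t := by omega
    have e7 : 2 * s + 1 + (t + 2) - (s + 1) = s + t + 1 + 1 := by omega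
    have e8 : 2 * s + (t + 2) - (s + 1) = s + t + 1 := by omega
    have e9 : s + 1 + (t + 2) = s + t + 1 + 1 + 1 := by omega
    have e10 : s + (t + 2) = s + t + 1 + 1 := by omega
    have e11 : s + 1 + 1 + t = s + t + 1 + 1 := by omega
    have e12 : s + 1 + t = s + t + 1 := by omega
    have ch : (s + 1).choose 2 = s.choose 2 + s := by
      rw [Nat.choose_succ_succ' s 1, Nat.choose_one_right, add_comm]
    simp only [schurCoeff, e3, e4, e5, e6, e7, e8, e9, e10, e11, e12, ch, schurRec, qPoch_succ]
    field_simp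
    ring

/-- Both sums have `n + 1` terms, so the case `t = 0` is the whole difference. -/
theorem schurSum_odd (q a b : K) {n : ℕ} (hn : qPoch q q n ≠ 0) :
    schurSum q (schurRec q a b) (2 * n + 1) = schurSum q (schurRec q a b) (2 * n) +
      (-1) ^ (n + 1) * q ^ (5 * n.choose 2 + 6 * n + 1) * (a + q ^ (n + 1) * b) := by
  have h := sum_schurCoeff_sub q a b n 0 hn
  have e1 : (2 * n + 1) / 2 = n := by omega
  have e2 : 2 * n / 2 = n := by omega
  rw [← sub_eq_iff_eq_add', schurSum, schurSum, e1, e2, ← Finset.sum_sub_distrib]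
  refine h.trans ?_
  simp only [add_zero, qPoch_succ, schurRec]
  field_simp
  ring

/-- The case `t = 1`, except that the sum for `2 * n + 2` has an extra term `i = n + 1`, split off
and added back. -/
theorem schurSum_even (q a b : K) {n : ℕ} (hn : qPoch q q (n + 1) ≠ 0) :
    schurSum q (schurRec q a b) (2 * n + 2) = schurSum q (schurRec q a b) (2 * n + 1) +
      (-1) ^ (n + 1) * q ^ (5 * n.choose 2 + 8 * n + 3) * (b + q ^ (n + 1) * a) := by
  have hn' := qPoch_ne_zero_of_le (Nat.le_succ n) hn
  have h := sum_schurCoeff_sub q a b n 1 hn'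
  have e1 : (2 * n + 1) / 2 = n := by omega
  have e2 : (2 * n + 2) / 2 = n + 1 := by omega
  rw [← sub_eq_iff_eq_add', schurSum, schurSum, e1, e2, Finset.sum_range_succ, add_sub_right_comm,
    ← Finset.sum_sub_distrib]
  refine (congrArg (· + _) h).trans ?_
  have e3 : 2 * n + 2 - (n + 1) = n + 1 := by omega
  have e4 : 2 * n + 2 - 2 * (n + 1) = 0 := by omega
  have e5 : 2 * n + 2 + 2 - 2 * (n + 1) = 2 := by omega
  have ch : (n + 1).choose 2 = n.choose 2 + n := by
    rw [Nat.choose_succ_succ' n 1, Nat.choose_one_right, add_comm]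
  have hq : 1 - q ^ (n + 1) ≠ 0 := fun h => hn (by rw [qPoch_succ, h, mul_zero])
  simp only [schurCoeff, e3, e4, e5, ch, qPoch_succ, schurRec]
  field_simp
  ring

theorem weightedSum_eq_schurSum (x : ℕ → ℤ[X]) (y : ℕ → K) (q : K)
    (h : ∀ m, aeval q (x (m + 2)) = y (m + 2)) {k : ℕ} (hk : k = 0 ∨ k = 1) (n : ℕ) :
    weightedSum x q k n = schurSum q y (2 * n + k) := by
  have e : (2 * n + k) / 2 = n := by omega
  rw [weightedSum, schurSum, e, ← Finset.sum_range_reflect]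
  refine Finset.sum_congr rfl fun i hi => ?_
  obtain ⟨r, rfl⟩ := Nat.exists_eq_add_of_le (Nat.lt_succ_iff.1 (Finset.mem_range.1 hi))
  have e1 : i + r + 1 - 1 - i = r := by omega
  have e2 : i + r - r = i := by omega
  have e3 : 2 * (i + r) + k - 2 * i = 2 * r + k := by omega
  have e4 : 2 * (i + r) + k - i = i + r + r + k := by omega
  have e5 : 2 * (i + r) + k + 2 - 2 * i = 2 * r + k + 2 := by omega
  -- Exact halving, from `i * i = 2 * i.choose 2 + i`.
  have e6 : i * (5 * (i + r) + 3 * r + 4 * k + 5) / 2 =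
      5 * i.choose 2 + 5 * i + 2 * i * (2 * r + k) := by
    have hc := two_mul_choose_two_add i
    apply Nat.div_eq_of_eq_mul_left two_pos
    linarith
  simp only [schurCoeff, e1, e2, e3, e4, e5, e6, h]
  ring

theorem thetaTerm_eq {c j : ℤ} {m : ℕ} (q : K) (h : j * (5 * j + c) = m * 2) :
    thetaTerm c q j = (-1) ^ j * q ^ m := by
  rw [thetaTerm, h, Int.mul_ediv_cancel _ two_ne_zero, zpow_natCast]

theorem partialTheta_one (c : ℤ) (q : K) (n : ℕ) :
    partialTheta c q 1 n = partialTheta c q 0 n + thetaTerm c q (-(n : ℤ) - 1) := by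
  have : Finset.Icc (-(n : ℤ) - 1) n = insert (-(n : ℤ) - 1) (Finset.Icc (-(n : ℤ)) n) := by
    ext; simp; omega
  simp only [partialTheta, Nat.cast_one, Nat.cast_zero, sub_zero]
  rw [this, Finset.sum_insert (by simp), add_comm]

theorem partialTheta_zero_succ (c : ℤ) (q : K) (n : ℕ) :
    partialTheta c q 0 (n + 1) = partialTheta c q 1 n + thetaTerm c q (n + 1) := by
  have : Finset.Icc (-(n + 1 : ℤ)) (n + 1) = insert (n + 1 : ℤ) (Finset.Icc (-(n : ℤ) - 1) n) := by
    ext; simp; omega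
  simp only [partialTheta, Nat.cast_one, Nat.cast_zero, sub_zero, Nat.cast_add]
  rw [this, Finset.sum_insert (by simp), add_comm]

theorem neg_one_zpow_neg_sub_one (n : ℕ) : (-1 : K) ^ (-(n : ℤ) - 1) = (-1) ^ (n + 1) := by
  rw [← neg_add', zpow_neg, ← Nat.cast_succ, zpow_natCast, ← inv_pow, inv_neg_one]

theorem neg_one_zpow_add_one (n : ℕ) : (-1 : K) ^ ((n : ℤ) + 1) = (-1) ^ (n + 1) := by
  rw [← Nat.cast_succ, zpow_natCast]

theorem partialTheta_eq_schurSum {c : ℤ} {a b : K} (q : K)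
    (hodd : ∀ n : ℕ, thetaTerm c q (-(n : ℤ) - 1) =
      (-1) ^ (n + 1) * q ^ (5 * n.choose 2 + 6 * n + 1) * (a + q ^ (n + 1) * b))
    (heven : ∀ n : ℕ, thetaTerm c q (n + 1) =
      (-1) ^ (n + 1) * q ^ (5 * n.choose 2 + 8 * n + 3) * (b + q ^ (n + 1) * a))
    (hab : a + b = 1) {n : ℕ} (hn : qPoch q q n ≠ 0) :
    partialTheta c q 0 n = schurSum q (schurRec q a b) (2 * n) ∧
      partialTheta c q 1 n = schurSum q (schurRec q a b) (2 * n + 1) := by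
  have key : ∀ n : ℕ, qPoch q q n ≠ 0 →
      partialTheta c q 0 n = schurSum q (schurRec q a b) (2 * n) →
      partialTheta c q 1 n = schurSum q (schurRec q a b) (2 * n + 1) := by
    intro n hn h
    rw [partialTheta_one, h, hodd, schurSum_odd q a b hn]
  suffices h : partialTheta c q 0 n = schurSum q (schurRec q a b) (2 * n) from ⟨h, key n hn h⟩
  induction n with
  | zero =>
    -- At N = 0 the sum is the single value x_2 = a + b, against the theta term 1 at j = 0.
    simp [partialTheta, thetaTerm, schurSum, schurCoeff, schurRec, qPoch, add_comm b, hab]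
  | succ n ih =>
    have hn' := qPoch_ne_zero_of_le (Nat.le_succ n) hn
    rw [partialTheta_zero_succ, key n hn' (ih hn'), heven, mul_add_one, schurSum_even q a b hn]

theorem partialTheta_eq_weightedSum (q : K) {k n : ℕ} (hk : k = 0 ∨ k = 1)
    (hn : qPoch q q n ≠ 0) :
    partialTheta 1 q k n = weightedSum schurE q k n ∧
      partialTheta 3 q k n = weightedSum schurD q k n := by
  rw [weightedSum_eq_schurSum _ _ q (aeval_schurE q) hk,
    weightedSum_eq_schurSum _ _ q (aeval_schurD q) hk]
  -- For (a, b) = (0, 1) or (1, 0) each increment reduces to a single power of `q`, that of the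
  -- theta term.
  have hE := partialTheta_eq_schurSum (c := 1) (a := 0) (b := 1) q
    (fun n => by
      rw [thetaTerm_eq (m := 5 * n.choose 2 + 7 * n + 2), neg_one_zpow_neg_sub_one]
      · ring
      · have := two_mul_choose_two_add n; zify at this; push_cast; linear_combination (-5) * this)
    (fun n => by
      rw [thetaTerm_eq (m := 5 * n.choose 2 + 8 * n + 3), neg_one_zpow_add_one]
      · ring
      · have := two_mul_choose_two_add n; zify at this; push_cast; linear_combination (-5) * this)
    (by simp) hn
  have hD := partialTheta_eq_schurSum (c := 3) (a := 1) (b := 0) q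
    (fun n => by
      rw [thetaTerm_eq (m := 5 * n.choose 2 + 6 * n + 1), neg_one_zpow_neg_sub_one]
      · ring
      · have := two_mul_choose_two_add n; zify at this; push_cast; linear_combination (-5) * this)
    (fun n => by
      rw [thetaTerm_eq (m := 5 * n.choose 2 + 9 * n + 4), neg_one_zpow_add_one]
      · ring
      · have := two_mul_choose_two_add n; zify at this; push_cast; linear_combination (-5) * this)
    (by simp) hn
  rcases hk with rfl | rfl
  · exact ⟨hE.1, hD.1⟩
  · exact ⟨hE.2, hD.2⟩

end Finite

/-! ### Limits of both sides -/

section Limits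

variable {q : ℂ}

theorem summable_norm_pow_linear (hq : ‖q‖ < 1) {d : ℕ} (hd : d ≠ 0) (e : ℕ) :
    Summable fun i : ℕ => ‖-q ^ (d * i + e)‖ := by
  have h : ‖q‖ ^ d < 1 := pow_lt_one₀ (norm_nonneg _) hq hd
  refine ((summable_geometric_of_lt_one (by positivity) h).mul_right (‖q‖ ^ e)).congr fun i => ?_
  rw [norm_neg, norm_pow, pow_add, pow_mul]

theorem one_sub_pow_ne_zero (hq : ‖q‖ < 1) {m : ℕ} (hm : m ≠ 0) : 1 - q ^ m ≠ 0 := by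
  intro h
  have h1 : ‖q ^ m‖ < 1 := by rw [norm_pow]; exact pow_lt_one₀ (norm_nonneg _) hq hm
  rw [← sub_eq_zero.1 h, norm_one] at h1
  exact lt_irrefl _ h1

theorem multipliable_one_sub_pow_linear (hq : ‖q‖ < 1) {d : ℕ} (hd : d ≠ 0) (e : ℕ) :
    Multipliable fun i : ℕ => 1 - q ^ (d * i + e) := by
  simpa only [sub_eq_add_neg] using
    multipliable_one_add_of_summable (summable_norm_pow_linear hq hd e)

theorem tprod_one_sub_pow_linear_ne_zero (hq : ‖q‖ < 1) {d e : ℕ} (hd : d ≠ 0) (he : e ≠ 0) :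
    ∏' i : ℕ, (1 - q ^ (d * i + e)) ≠ 0 := by
  simp only [sub_eq_add_neg]
  refine tprod_one_add_ne_zero_of_summable (fun i => ?_) (summable_norm_pow_linear hq hd e)
  rw [← sub_eq_add_neg]
  exact one_sub_pow_ne_zero hq (by omega)

theorem qPoch_ne_zero (hq : ‖q‖ < 1) (n : ℕ) : qPoch q q n ≠ 0 := by
  rw [qPoch, Finset.prod_ne_zero_iff]
  intro j _
  rw [← pow_succ']
  exact one_sub_pow_ne_zero hq j.succ_ne_zero

theorem multipliable_one_sub_pow_succ (hq : ‖q‖ < 1) : Multipliable fun i : ℕ => 1 - q ^ (i + 1) := by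
  simpa using multipliable_one_sub_pow_linear hq one_ne_zero 1

theorem tprod_one_sub_pow_succ_ne_zero (hq : ‖q‖ < 1) : ∏' i : ℕ, (1 - q ^ (i + 1)) ≠ 0 := by
  simpa using tprod_one_sub_pow_linear_ne_zero hq one_ne_zero one_ne_zero

theorem tendsto_qPoch (hq : ‖q‖ < 1) :
    Tendsto (qPoch q q) atTop (𝓝 (∏' i : ℕ, (1 - q ^ (i + 1)))) := by
  refine (multipliable_one_sub_pow_succ hq).hasProd.tendsto_prod_nat.congr fun n => ?_
  simp only [qPoch, pow_succ']

theorem exists_norm_le_of_tendsto {f : ℕ → ℂ} {l : ℂ} (h : Tendsto f atTop (𝓝 l)) :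
    ∃ C, 0 ≤ C ∧ ∀ n, ‖f n‖ ≤ C := by
  obtain ⟨C, hC⟩ := h.norm.bddAbove_range
  exact ⟨C, (norm_nonneg _).trans (hC ⟨0, rfl⟩), fun n => hC ⟨n, rfl⟩⟩

theorem tendsto_inv_qPoch (hq : ‖q‖ < 1) :
    Tendsto (fun n => (qPoch q q n)⁻¹) atTop (𝓝 (∏' i : ℕ, (1 - q ^ (i + 1)))⁻¹) :=
  (tendsto_qPoch hq).inv₀ (tprod_one_sub_pow_succ_ne_zero hq)

/-- The series `∑ q^{m^2 + i m} / (q;q)_m`. -/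
noncomputable def rrSeries (q : ℂ) (i : ℕ) : ℂ := ∑' m : ℕ, q ^ (m ^ 2 + i * m) / qPoch q q m

theorem exists_norm_rrSeries_term_le (hq : ‖q‖ < 1) :
    ∃ C, ∀ i m : ℕ, ‖q ^ (m ^ 2 + i * m) / qPoch q q m‖ ≤ C * ‖q‖ ^ m := by
  obtain ⟨C, hC0, hC⟩ := exists_norm_le_of_tendsto (tendsto_inv_qPoch hq)
  refine ⟨C, fun i m => ?_⟩
  rw [div_eq_mul_inv, norm_mul, norm_pow, mul_comm]
  have hm : m ≤ m ^ 2 + i * m := (Nat.le_self_pow two_ne_zero m).trans (Nat.le_add_right _ _)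
  exact mul_le_mul (hC m) (pow_le_pow_of_le_one (norm_nonneg _) hq.le hm) (by positivity) hC0

theorem summable_rrSeries (hq : ‖q‖ < 1) (i : ℕ) :
    Summable fun m : ℕ => q ^ (m ^ 2 + i * m) / qPoch q q m := by
  obtain ⟨C, hC⟩ := exists_norm_rrSeries_term_le hq
  exact ((summable_geometric_of_lt_one (norm_nonneg _) hq).mul_left C).of_norm_bounded (hC i)

/-- Subtracting termwise gives a factor `1 - q ^ m`, which kills `m = 0` and cancels the last factor
of (q;q)_m; then shift `m`. -/
theorem rrSeries_rec (hq : ‖q‖ < 1) (i : ℕ) :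
    rrSeries q i = rrSeries q (i + 1) + q ^ (i + 1) * rrSeries q (i + 2) := by
  have h := (summable_rrSeries hq i).sub (summable_rrSeries hq (i + 1))
  rw [← sub_eq_iff_eq_add', rrSeries, rrSeries, rrSeries,
    ← (summable_rrSeries hq i).tsum_sub (summable_rrSeries hq (i + 1)), h.tsum_eq_zero_add,
    ← tsum_mul_left]
  simp only [mul_zero, sub_self, zero_add]
  refine tsum_congr fun m => ?_
  have h1 := one_sub_pow_ne_zero hq m.succ_ne_zero
  have h2 := qPoch_ne_zero hq m
  rw [qPoch_succ]
  field_simp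
  ring

theorem tendsto_rrSeries (hq : ‖q‖ < 1) : Tendsto (rrSeries q) atTop (𝓝 1) := by
  obtain ⟨C, hC⟩ := exists_norm_rrSeries_term_le hq
  have h1 : (1 : ℂ) = ∑' m : ℕ, if m = 0 then 1 else 0 := by simp
  rw [h1]
  refine tendsto_tsum_of_dominated_convergence (bound := fun m => C * ‖q‖ ^ m)
    ((summable_geometric_of_lt_one (norm_nonneg _) hq).mul_left C) (fun m => ?_)
    (Eventually.of_forall fun i m => hC i m)
  rcases eq_or_ne m 0 with rfl | hm
  · simp [qPoch]
  · rw [if_neg hm]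
    have hqm : ‖q ^ m‖ < 1 := by rw [norm_pow]; exact pow_lt_one₀ (norm_nonneg _) hq hm
    have := ((tendsto_pow_atTop_nhds_zero_of_norm_lt_one hqm).const_mul (q ^ m ^ 2)).div_const
      (qPoch q q m)
    rw [mul_zero, zero_div] at this
    refine this.congr fun i => ?_
    rw [pow_add, mul_comm i, pow_mul]

/-- The two recurrences are adjoint, so this pairing does not depend on `i`; its value is read off
at `i = 0`. -/
theorem schurRec_mul_rrSeries (hq : ‖q‖ < 1) (a b : ℂ) (i : ℕ) :
    schurRec q a b (i + 1) * rrSeries q i + q ^ i * schurRec q a b i * rrSeries q (i + 1) =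
      b * rrSeries q 0 + a * rrSeries q 1 := by
  induction i with
  | zero => simp [schurRec]
  | succ i ih =>
    rw [← ih, rrSeries_rec hq i, schurRec]
    ring

/-- The maximum of two consecutive norms grows by a factor of at most 1 + |q|^n ≤ exp(|q|^n) per
step. -/
theorem exists_norm_schurRec_le (hq : ‖q‖ < 1) (a b : ℂ) :
    ∃ C, ∀ n, ‖schurRec q a b n‖ ≤ C := by
  have key : ∀ n, max ‖schurRec q a b n‖ ‖schurRec q a b (n + 1)‖ ≤
      max ‖a‖ ‖b‖ * Real.exp (∑ i ∈ Finset.range n, ‖q‖ ^ i) := by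
    intro n
    induction n with
    | zero => simp [schurRec]
    | succ n ih =>
      set M := max ‖schurRec q a b n‖ ‖schurRec q a b (n + 1)‖
      have hM : 0 ≤ M := (norm_nonneg _).trans (le_max_left _ _)
      have h1 : max ‖schurRec q a b (n + 1)‖ ‖schurRec q a b (n + 2)‖ ≤ M * (‖q‖ ^ n + 1) := by
        have hr : ‖schurRec q a b (n + 1)‖ ≤ M := le_max_right _ _
        have hl : ‖schurRec q a b n‖ ≤ M := le_max_left _ _
        have hp : 0 ≤ M * ‖q‖ ^ n := by positivity
        refine max_le (by linarith) ?_
        rw [schurRec]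
        refine (norm_add_le _ _).trans ?_
        rw [norm_mul, norm_pow]
        have := mul_le_mul_of_nonneg_left hl (pow_nonneg (norm_nonneg q) n)
        linarith
      rw [Finset.sum_range_succ, Real.exp_add, ← mul_assoc]
      exact h1.trans (mul_le_mul ih (Real.add_one_le_exp _) (by positivity) (hM.trans ih))
  refine ⟨max ‖a‖ ‖b‖ * Real.exp (∑' i, ‖q‖ ^ i), fun n => (le_max_left _ _).trans
    ((key n).trans ?_)⟩
  gcongr
  exact (summable_geometric_of_lt_one (norm_nonneg _) hq).sum_le_tsum _ fun i _ => by positivity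

/-- In the invariant pairing the second summand tends to 0, as `x` is bounded, and `rrSeries q i`
tends to 1. -/
theorem tendsto_schurRec (hq : ‖q‖ < 1) (a b : ℂ) :
    Tendsto (schurRec q a b) atTop (𝓝 (b * rrSeries q 0 + a * rrSeries q 1)) := by
  obtain ⟨C, hC⟩ := exists_norm_schurRec_le hq a b
  have hF := tendsto_rrSeries hq
  have h0 : Tendsto (fun i => q ^ i * schurRec q a b i) atTop (𝓝 0) := by
    refine squeeze_zero_norm (a := fun i => ‖q‖ ^ i * C) (fun i => ?_) ?_
    · rw [norm_mul, norm_pow]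
      gcongr
      exact hC i
    · simpa using (tendsto_pow_atTop_nhds_zero_of_lt_one (norm_nonneg _) hq).mul_const C
  have h := ((tendsto_const_nhds (x := b * rrSeries q 0 + a * rrSeries q 1)).sub
    (h0.mul (hF.comp (tendsto_add_atTop_nat 1)))).div hF one_ne_zero
  rw [zero_mul, sub_zero, div_one] at h
  rw [← tendsto_add_atTop_iff_nat 1]
  refine h.congr' ?_
  filter_upwards [hF.eventually_ne one_ne_zero] with i hi
  simp only [Function.comp_apply, Pi.div_apply]
  rw [div_eq_iff hi, ← schurRec_mul_rrSeries hq a b i]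
  ring

/-- Dominated convergence with bound a multiple of |q|^i; the coefficient at `i = 0` is (q;q)_N. -/
theorem tendsto_schurSum (hq : ‖q‖ < 1) {x : ℕ → ℂ} {l : ℂ} (hx : Tendsto x atTop (𝓝 l)) :
    Tendsto (schurSum q x) atTop (𝓝 ((∏' i : ℕ, (1 - q ^ (i + 1))) * l)) := by
  obtain ⟨A, hA0, hA⟩ := exists_norm_le_of_tendsto (tendsto_qPoch hq)
  obtain ⟨B, hB0, hB⟩ := exists_norm_le_of_tendsto (tendsto_inv_qPoch hq)
  obtain ⟨C, hC0, hC⟩ := exists_norm_le_of_tendsto hx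
  set P := ∏' i : ℕ, (1 - q ^ (i + 1))
  have bound : ∀ N i m : ℕ, m ≤ 5 * i.choose 2 + 5 * i + 2 * i * (N - 2 * i) →
      ‖schurCoeff q N i * x (N + 2 - 2 * i)‖ ≤ A * B * C * ‖q‖ ^ m := by
    intro N i m hm
    have h := pow_le_pow_of_le_one (norm_nonneg q) hq.le hm
    calc ‖schurCoeff q N i * x (N + 2 - 2 * i)‖ =
        ‖q‖ ^ (5 * i.choose 2 + 5 * i + 2 * i * (N - 2 * i)) *
          (‖qPoch q q (N - i)‖ * ‖(qPoch q q i)⁻¹‖) * ‖x (N + 2 - 2 * i)‖ := by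
          simp [schurCoeff, div_eq_mul_inv]
      _ ≤ ‖q‖ ^ m * (A * B) * C := by
          gcongr
          exacts [hA _, hB _, hC _]
      _ = _ := by ring
  have hsum : ∀ N, schurSum q x N =
      ∑' i, if 2 * i ≤ N then schurCoeff q N i * x (N + 2 - 2 * i) else 0 := by
    intro N
    rw [tsum_eq_sum (s := Finset.range (N / 2 + 1)), schurSum]
    · refine Finset.sum_congr rfl fun i hi => (if_pos ?_).symm
      have := Finset.mem_range.1 hi
      omega
    · intro i hi
      rw [Finset.mem_range] at hi
      exact if_neg (by omega)
  have hlim : P * l = ∑' i : ℕ, if i = 0 then P * l else 0 := by simp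
  rw [funext hsum, hlim]
  refine tendsto_tsum_of_dominated_convergence (bound := fun i => A * B * C * ‖q‖ ^ i)
    ((summable_geometric_of_lt_one (norm_nonneg _) hq).mul_left _) (fun i => ?_)
    (Eventually.of_forall fun N i => ?_)
  · rcases eq_or_ne i 0 with rfl | hi
    · have h2 : Tendsto (fun N => x (N + 2)) atTop (𝓝 l) := (tendsto_add_atTop_iff_nat 2).2 hx
      refine ((tendsto_qPoch hq).mul h2).congr fun N => ?_
      simp [schurCoeff]
      simp [qPoch]
    · rw [if_neg hi]
      -- For `i ≥ 1` the exponent is at least `N - 2 * i`; where that subtraction truncates, the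
      -- term is 0.
      refine squeeze_zero_norm (a := fun N => A * B * C * ‖q‖ ^ (N - 2 * i)) (fun N => ?_) ?_
      · split_ifs
        · refine bound _ _ _ ?_
          have := Nat.le_mul_of_pos_left (N - 2 * i) (show 0 < 2 * i by omega)
          omega
        · rw [norm_zero]
          positivity
      · simpa using ((tendsto_pow_atTop_nhds_zero_of_lt_one (norm_nonneg _) hq).comp
          (tendsto_sub_atTop_nat (2 * i))).const_mul (A * B * C)
  · split_ifs
    · refine bound _ _ _ ?_
      have : 0 ≤ 2 * i * (N - 2 * i) := Nat.zero_le _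
      omega
    · rw [norm_zero]
      positivity

theorem tendsto_weightedSum (hq : ‖q‖ < 1) {x : ℕ → ℤ[X]} {a b : ℂ}
    (h : ∀ m, aeval q (x (m + 2)) = schurRec q a b (m + 2)) {k : ℕ} (hk : k = 0 ∨ k = 1) :
    Tendsto (fun n => weightedSum x q k n) atTop
      (𝓝 ((∏' i : ℕ, (1 - q ^ (i + 1))) * (b * rrSeries q 0 + a * rrSeries q 1))) := by
  have hN : Tendsto (fun n : ℕ => 2 * n + k) atTop atTop :=
    tendsto_atTop_mono (fun n => by simp only [id]; omega) tendsto_id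
  refine ((tendsto_schurSum hq (tendsto_schurRec hq a b)).comp hN).congr fun n => ?_
  exact (weightedSum_eq_schurSum _ _ q h hk n).symm

/-- Since j² ≥ |j|, j(5j + c) ≥ (5 - |c|)|j| ≥ 2|j|. -/
theorem norm_thetaTerm_le (hq : ‖q‖ < 1) {c : ℤ} (hc : |c| ≤ 3) (j : ℤ) :
    ‖thetaTerm c q j‖ ≤ ‖q‖ ^ j.natAbs := by
  have hj : 2 * (j.natAbs : ℤ) ≤ j * (5 * j + c) := by
    rw [Int.natCast_natAbs]
    have h1 : -(3 * |j|) ≤ c * j := by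
      have := neg_abs_le (c * j)
      rw [abs_mul] at this
      nlinarith [abs_nonneg j]
    have h2 : |j| ≤ j * j := by
      rw [← abs_mul_abs_self]
      rcases eq_or_ne j 0 with rfl | h
      · simp
      · nlinarith [Int.one_le_abs h]
    linarith
  obtain ⟨m, hm⟩ := Int.eq_ofNat_of_zero_le (a := j * (5 * j + c) / 2) (by omega)
  rw [thetaTerm, hm, zpow_natCast, norm_mul, norm_zpow, norm_neg, norm_one, one_zpow, one_mul,
    norm_pow]
  exact pow_le_pow_of_le_one (norm_nonneg _) hq.le (by omega)

theorem summable_norm_thetaTerm (hq : ‖q‖ < 1) {c : ℤ} (hc : |c| ≤ 3) :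
    Summable fun j => ‖thetaTerm c q j‖ := by
  refine Summable.of_nonneg_of_le (fun _ => norm_nonneg _) (norm_thetaTerm_le hq hc) ?_
  refine Summable.of_nat_of_neg ?_ ?_ <;>
  simpa using summable_geometric_of_lt_one (norm_nonneg _) hq

theorem tendsto_partialTheta {c : ℤ} (h : Summable (thetaTerm c q)) (k : ℕ) :
    Tendsto (fun n => partialTheta c q k n) atTop (𝓝 (∑' j : ℤ, thetaTerm c q j)) := by
  refine h.hasSum.comp (tendsto_atTop_finset_of_monotone ?_ fun j => ⟨j.natAbs, ?_⟩)
  · intro m n hmn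
    exact Finset.Icc_subset_Icc (by simp only [tsub_le_iff_right]; omega) (by omega)
  · rw [Finset.mem_Icc]
    omega

end Limits

/-! ### Jacobi's triple product and the product for (q;q)_∞ -/

section TripleProduct

/-- The reciprocal `1 / (p;p)_m`, equal to `0` for negative `m`. -/
noncomputable def invPoch (p : ℂ) (m : ℤ) : ℂ := if m < 0 then 0 else (qPoch p p m.toNat)⁻¹

variable {q : ℂ}

/-- The value 0 at negative arguments makes this hold for every integer; at `m = -1` the factor
vanishes. -/
theorem invPoch_eq {p : ℂ} (hp : ‖p‖ < 1) (m : ℤ) :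
    invPoch p m = (1 - p ^ (m + 1)) * invPoch p (m + 1) := by
  rcases lt_trichotomy m (-1) with h | rfl | h
  · rw [invPoch, invPoch, if_pos (by omega), if_pos (by omega), mul_zero]
  · simp [invPoch]
  · obtain ⟨n, rfl⟩ := Int.eq_ofNat_of_zero_le (show 0 ≤ m by omega)
    have h1 := one_sub_pow_ne_zero hp n.succ_ne_zero
    have h2 := qPoch_ne_zero hp n
    have e : ((n : ℤ) + 1).toNat = n + 1 := by omega
    rw [invPoch, invPoch, if_neg (by omega), if_neg (by omega), Int.toNat_natCast, e, qPoch_succ,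
      ← Nat.cast_succ, zpow_natCast]
    field_simp

theorem thetaTerm_add_one (hq0 : q ≠ 0) {u v : ℕ} (huv : u + v = 5) (j : ℤ) :
    thetaTerm (u - v) q (j + 1) = -(q ^ (5 * j) * q ^ u) * thetaTerm (u - v) q j := by
  have e : (j + 1) * (5 * (j + 1) + (u - v)) / 2 = j * (5 * j + (u - v)) / 2 + (5 * j + u) := by
    have : (j + 1) * (5 * (j + 1) + (u - v)) = j * (5 * j + (u - v)) + (5 * j + u) * 2 := by
      have : (u : ℤ) + v = 5 := by exact_mod_cast huv
      linear_combination -this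
    rw [this, Int.add_mul_ediv_right _ _ two_ne_zero]
  rw [thetaTerm, thetaTerm, e, zpow_add₀ hq0 _ (5 * j + u), zpow_add₀ hq0 (5 * j),
    zpow_add₀ (by norm_num), zpow_natCast, zpow_one]
  ring

/-- Summed over `j`, the shifts disappear and the right side acquires the factor 1 + q^(10n+5) -
q^(5n+u) - q^(5n+v) = (1 - q^(5n+u))(1 - q^(5n+v)). -/
theorem tripleProduct_term_succ (hq : ‖q‖ < 1) (hq0 : q ≠ 0) {u v : ℕ} (huv : u + v = 5)
    (n : ℕ) (j : ℤ) :
    (1 - q ^ (10 * n + 5)) * (1 - q ^ (10 * n + 10)) *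
        (thetaTerm (u - v) q j * invPoch (q ^ 5) (n + 1 - j) * invPoch (q ^ 5) (n + 1 + j)) =
      (1 + q ^ (10 * n + 5)) *
          (thetaTerm (u - v) q j * invPoch (q ^ 5) (n - j) * invPoch (q ^ 5) (n + j)) -
        q ^ (5 * n + u) * (thetaTerm (u - v) q (j - 1) * invPoch (q ^ 5) (n - (j - 1)) *
          invPoch (q ^ 5) (n + (j - 1))) -
        q ^ (5 * n + v) * (thetaTerm (u - v) q (j + 1) * invPoch (q ^ 5) (n - (j + 1)) *
          invPoch (q ^ 5) (n + (j + 1))) := by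
  have hp : ‖q ^ 5‖ < 1 := by rw [norm_pow]; exact pow_lt_one₀ (norm_nonneg _) hq (by norm_num)
  have hJ : q ^ (5 * j) ≠ 0 := zpow_ne_zero _ hq0
  have hU : q ^ u ≠ 0 := pow_ne_zero _ hq0
  have hT : thetaTerm (u - v) q (j - 1) =
      -(thetaTerm (u - v) q j * q ^ 5 / (q ^ (5 * j) * q ^ u)) := by
    have h := thetaTerm_add_one hq0 huv (j - 1)
    rw [sub_add_cancel, mul_sub, zpow_sub₀ hq0] at h
    rw [h]
    norm_cast
    field_simp
  have hpow : ∀ m : ℤ, (q ^ 5) ^ m = q ^ (5 * m) := fun m => by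
    rw [zpow_mul]; norm_cast
  have hv : q ^ v = q ^ 5 / q ^ u := by rw [← huv, pow_add]; field_simp
  have a1 := invPoch_eq hp (n - j)
  have a2 := invPoch_eq hp (n - (j + 1))
  have b1 := invPoch_eq hp (n + j)
  have b2 := invPoch_eq hp (n + (j - 1))
  have e1 : (n : ℤ) - (j + 1) + 1 = n - j := by ring
  have e2 : (n : ℤ) + (j - 1) + 1 = n + j := by ring
  have e3 : (n : ℤ) - j + 1 = n + 1 - j := by ring
  have e4 : (n : ℤ) + j + 1 = n + 1 + j := by ring
  have e5 : (n : ℤ) - (j - 1) = n + 1 - j := by ring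
  have e6 : (n : ℤ) + (j + 1) = n + 1 + j := by ring
  rw [e3] at a1
  rw [e4] at b1
  rw [e1, a1] at a2
  rw [e2, b1] at b2
  have c1 : (q ^ 5) ^ (n + 1 - j : ℤ) = q ^ (5 * n) * q ^ 5 / q ^ (5 * j) := by
    rw [hpow, mul_sub, zpow_sub₀ hq0]; norm_cast; rw [mul_add, pow_add]
  have c2 : (q ^ 5) ^ (n - j : ℤ) = q ^ (5 * n) / q ^ (5 * j) := by
    rw [hpow, mul_sub, zpow_sub₀ hq0]; norm_cast
  have c3 : (q ^ 5) ^ (n + 1 + j : ℤ) = q ^ (5 * n) * q ^ 5 * q ^ (5 * j) := by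
    rw [hpow, mul_add, zpow_add₀ hq0]; norm_cast; rw [mul_add, pow_add]
  have c4 : (q ^ 5) ^ (n + j : ℤ) = q ^ (5 * n) * q ^ (5 * j) := by
    rw [hpow, mul_add, zpow_add₀ hq0]; norm_cast
  rw [a2, b2, a1, b1, e5, e6, hT, thetaTerm_add_one hq0 huv, c1, c2, c3, c4, pow_add _ _ u,
    pow_add _ _ v, hv]
  have d : q ^ (10 * n + 5) = q ^ (5 * n) * q ^ (5 * n) * q ^ 5 := by ring
  have d' : q ^ (10 * n + 10) = q ^ (5 * n) * q ^ (5 * n) * q ^ 5 * q ^ 5 := by ring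
  rw [d, d']
  -- Every term is now a multiple of the same theta term and reciprocals at `n + 1 ± j`; a rational
  -- identity remains.
  generalize q ^ (5 * n) = N
  generalize q ^ (5 * j) = J at *
  generalize q ^ u = U at *
  field_simp
  ring

theorem hasSum_finite_tripleProduct (hq : ‖q‖ < 1) (hq0 : q ≠ 0) {u v : ℕ} (huv : u + v = 5)
    (n : ℕ) :
    HasSum (fun j : ℤ =>
        thetaTerm (u - v) q j * invPoch (q ^ 5) (n - j) * invPoch (q ^ 5) (n + j))
      ((∏ i ∈ Finset.range n, ((1 - q ^ (5 * i + u)) * (1 - q ^ (5 * i + v)))) /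
        qPoch (q ^ 5) (q ^ 5) (2 * n)) := by
  induction n with
  | zero =>
    -- For `j ≠ 0` one of the arguments `-j`, `j` is negative.
    have h : ∀ j : ℤ, j ≠ 0 → thetaTerm (u - v) q j * invPoch (q ^ 5) ((0 : ℕ) - j) *
        invPoch (q ^ 5) ((0 : ℕ) + j) = 0 := by
      intro j hj
      rcases lt_or_gt_of_ne hj with h | h
      · rw [invPoch.eq_1 _ (_ + j), if_pos (by simpa using h), mul_zero]
      · rw [invPoch.eq_1 _ (_ - j), if_pos (by simpa using h), mul_zero, zero_mul]
    convert hasSum_single 0 h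
    simp [invPoch, qPoch, thetaTerm]
  | succ n ih =>
    have h1 := (Equiv.subRight (1 : ℤ)).hasSum_iff.2 ih
    have h2 := (Equiv.addRight (1 : ℤ)).hasSum_iff.2 ih
    have h := ((ih.mul_left (1 + q ^ (10 * n + 5))).sub (h1.mul_left (q ^ (5 * n + u)))).sub
      (h2.mul_left (q ^ (5 * n + v)))
    have n1 := one_sub_pow_ne_zero hq (show 10 * n + 5 ≠ 0 by omega)
    have n2 := one_sub_pow_ne_zero hq (show 10 * n + 10 ≠ 0 by omega)
    have hp : ‖q ^ 5‖ < 1 := by rw [norm_pow]; exact pow_lt_one₀ (norm_nonneg _) hq (by norm_num)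
    have n3 := qPoch_ne_zero hp (2 * n)
    have h' := h.mul_left ((1 - q ^ (10 * n + 5)) * (1 - q ^ (10 * n + 10)))⁻¹
    convert h' using 1
    · rfl
    · funext j
      have := tripleProduct_term_succ hq hq0 huv n j
      rw [eq_inv_mul_iff_mul_eq₀ (mul_ne_zero n1 n2)]
      simpa [Nat.cast_succ] using this
    · have hv : q ^ (10 * n + 5) = q ^ (5 * n + u) * q ^ (5 * n + v) := by
        rw [← pow_add]; congr 1; omega
      have d1 : (q ^ 5) ^ (2 * n + 1) = q ^ (10 * n + 5) := by ring
      have d2 : (q ^ 5) ^ (2 * n + 1 + 1) = q ^ (10 * n + 10) := by ring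
      rw [Finset.prod_range_succ, mul_add_one, qPoch_succ, qPoch_succ, d1, d2]
      field_simp
      rw [hv]
      ring

theorem tendsto_invPoch {p : ℂ} (hp : ‖p‖ < 1) {f : ℕ → ℤ} (hf : Tendsto f atTop atTop) :
    Tendsto (fun n => invPoch p (f n)) atTop (𝓝 (∏' i : ℕ, (1 - p ^ (i + 1)))⁻¹) := by
  have h : Tendsto (fun n => (f n).toNat) atTop atTop :=
    (tendsto_atTop_atTop.2 fun b => ⟨b, fun a ha => by omega⟩ :
      Tendsto Int.toNat atTop atTop).comp hf
  refine ((tendsto_inv_qPoch hp).comp h).congr' ?_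
  filter_upwards [hf.eventually_ge_atTop 0] with n hn
  rw [invPoch, if_neg (by omega), Function.comp_apply]

theorem multipliable_pair (hq : ‖q‖ < 1) (u v : ℕ) :
    Multipliable fun i : ℕ => (1 - q ^ (5 * i + u)) * (1 - q ^ (5 * i + v)) :=
  (multipliable_one_sub_pow_linear hq (by norm_num) u).mul
    (multipliable_one_sub_pow_linear hq (by norm_num) v)

theorem tprod_pair_ne_zero (hq : ‖q‖ < 1) {u v : ℕ} (hu : u ≠ 0) (hv : v ≠ 0) :
    ∏' i : ℕ, ((1 - q ^ (5 * i + u)) * (1 - q ^ (5 * i + v))) ≠ 0 := by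
  rw [(multipliable_one_sub_pow_linear hq (by norm_num) u).tprod_mul
    (multipliable_one_sub_pow_linear hq (by norm_num) v)]
  exact mul_ne_zero (tprod_one_sub_pow_linear_ne_zero hq (by norm_num) hu)
    (tprod_one_sub_pow_linear_ne_zero hq (by norm_num) hv)

/-- Let `n → ∞` in the finite form: the summands tend to theta terms over P², the right side to R /
P. -/
theorem tsum_thetaTerm_eq_tprod (hq : ‖q‖ < 1) (hq0 : q ≠ 0) {u v : ℕ} (huv : u + v = 5)
    (hc : |(u - v : ℤ)| ≤ 3) :
    ∑' j, thetaTerm (u - v) q j = (∏' i : ℕ, (1 - (q ^ 5) ^ (i + 1))) *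
      ∏' i : ℕ, ((1 - q ^ (5 * i + u)) * (1 - q ^ (5 * i + v))) := by
  have hp : ‖q ^ 5‖ < 1 := by rw [norm_pow]; exact pow_lt_one₀ (norm_nonneg _) hq (by norm_num)
  have hP := tprod_one_sub_pow_succ_ne_zero hp
  obtain ⟨B, hB0, hB⟩ := exists_norm_le_of_tendsto (tendsto_inv_qPoch hp)
  have hB' : ∀ m, ‖invPoch (q ^ 5) m‖ ≤ B := by
    intro m
    rw [invPoch]
    split_ifs
    · simpa using hB0
    · exact hB _
  set P := ∏' i : ℕ, (1 - (q ^ 5) ^ (i + 1))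
  set R := ∏' i : ℕ, ((1 - q ^ (5 * i + u)) * (1 - q ^ (5 * i + v)))
  have hl : Tendsto (fun n : ℕ => ∑' j : ℤ,
      thetaTerm (u - v) q j * invPoch (q ^ 5) (n - j) * invPoch (q ^ 5) (n + j)) atTop
      (𝓝 (∑' j : ℤ, thetaTerm (u - v) q j * P⁻¹ * P⁻¹)) := by
    refine tendsto_tsum_of_dominated_convergence
      (bound := fun j => ‖thetaTerm (u - v : ℤ) q j‖ * B * B)
      (((summable_norm_thetaTerm hq hc).mul_right B).mul_right B) (fun j => ?_)
      (Eventually.of_forall fun n j => ?_)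
    · refine (tendsto_const_nhds.mul (tendsto_invPoch hp ?_)).mul (tendsto_invPoch hp ?_)
      · exact tendsto_atTop_add_const_right _ (-j) tendsto_natCast_atTop_atTop
      · exact tendsto_atTop_add_const_right _ j tendsto_natCast_atTop_atTop
    · rw [norm_mul, norm_mul]
      gcongr
      exacts [hB' _, hB' _]
  have hr : Tendsto (fun n : ℕ => ∑' j : ℤ,
      thetaTerm (u - v) q j * invPoch (q ^ 5) (n - j) * invPoch (q ^ 5) (n + j)) atTop
      (𝓝 (R / P)) := by
    have h2 : Tendsto (fun n : ℕ => 2 * n) atTop atTop :=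
      tendsto_atTop_mono (fun n => by simp only [id]; omega) tendsto_id
    refine ((multipliable_pair hq u v).hasProd.tendsto_prod_nat.div
      ((tendsto_qPoch hp).comp h2) hP).congr fun n => ?_
    exact (hasSum_finite_tripleProduct hq hq0 huv n).tsum_eq.symm
  have := tendsto_nhds_unique hl hr
  rw [tsum_mul_right, tsum_mul_right] at this
  field_simp at this
  linear_combination this

/-- Sort the factors by exponent modulo 5. -/
theorem tprod_one_sub_pow_succ_eq (hq : ‖q‖ < 1) :
    ∏' i : ℕ, (1 - q ^ (i + 1)) = (∏' i : ℕ, (1 - (q ^ 5) ^ (i + 1))) *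
      (∏' i : ℕ, ((1 - q ^ (5 * i + 1)) * (1 - q ^ (5 * i + 4)))) *
      ∏' i : ℕ, ((1 - q ^ (5 * i + 2)) * (1 - q ^ (5 * i + 3))) := by
  have hp : ‖q ^ 5‖ < 1 := by rw [norm_pow]; exact pow_lt_one₀ (norm_nonneg _) hq (by norm_num)
  have h5 : Tendsto (fun n : ℕ => 5 * n) atTop atTop :=
    tendsto_atTop_mono (fun n => by simp only [id]; omega) tendsto_id
  refine tendsto_nhds_unique ((tendsto_qPoch hq).comp h5)
    ((((tendsto_qPoch hp).mul (multipliable_pair hq 1 4).hasProd.tendsto_prod_nat).mul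
      (multipliable_pair hq 2 3).hasProd.tendsto_prod_nat).congr fun n => ?_)
  simp only [Function.comp_apply]
  induction n with
  | zero => simp [qPoch]
  | succ n ih =>
    have e : 5 * (n + 1) = 5 * n + 1 + 1 + 1 + 1 + 1 := by ring
    rw [Finset.prod_range_succ, Finset.prod_range_succ, qPoch_succ, e]
    simp only [qPoch_succ q]
    rw [← ih]
    ring

end TripleProduct

/-! ### The Rogers–Ramanujan identities -/

theorem hasSum_rrSeries_of_eq {q : ℂ} (hq : ‖q‖ < 1) {i u v u' v' : ℕ} {x : ℕ → ℤ[X]}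
    (huv : u + v = 5) (hc : |(u - v : ℤ)| ≤ 3) (hu : u ≠ 0) (hv : v ≠ 0) (hu' : u' ≠ 0)
    (hv' : v' ≠ 0)
    (hlim : Tendsto (fun n => weightedSum x q 0 n) atTop
      (𝓝 ((∏' i : ℕ, (1 - q ^ (i + 1))) * rrSeries q i)))
    (hid : ∀ n, partialTheta (u - v) q 0 n = weightedSum x q 0 n)
    (hprod : ∏' i : ℕ, (1 - q ^ (i + 1)) = (∏' i : ℕ, (1 - (q ^ 5) ^ (i + 1))) *
      (∏' i : ℕ, ((1 - q ^ (5 * i + u')) * (1 - q ^ (5 * i + v')))) *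
      ∏' i : ℕ, ((1 - q ^ (5 * i + u)) * (1 - q ^ (5 * i + v)))) :
    Multipliable (fun j : ℕ => 1 / ((1 - q ^ (5 * j + u')) * (1 - q ^ (5 * j + v')))) ∧
      HasSum (fun m : ℕ => q ^ (m ^ 2 + i * m) / qPoch q q m)
        (∏' j : ℕ, 1 / ((1 - q ^ (5 * j + u')) * (1 - q ^ (5 * j + v')))) := by
  have hR' := tprod_pair_ne_zero hq hu' hv'
  have hinv := (multipliable_pair hq u' v').hasProd.inv₀ hR'
  simp only [one_div]
  refine ⟨hinv.multipliable, ?_⟩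
  rw [hinv.tprod_eq]
  have hF : rrSeries q i = (∏' i : ℕ, ((1 - q ^ (5 * i + u')) * (1 - q ^ (5 * i + v'))))⁻¹ := by
    -- The triple product argument divides by powers of `q`; at `q = 0` both sides are 1.
    rcases eq_or_ne q 0 with rfl | hq0
    · rw [rrSeries, tsum_eq_single 0 fun m hm => by simp [hm]]
      simp [qPoch, hu', hv']
    · have hp : ‖q ^ 5‖ < 1 := by
        rw [norm_pow]; exact pow_lt_one₀ (norm_nonneg _) hq (by norm_num)
      have h := tendsto_nhds_unique
        ((tendsto_partialTheta (summable_norm_thetaTerm hq hc).of_norm 0).congr hid) hlim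
      rw [tsum_thetaTerm_eq_tprod hq hq0 huv hc, hprod] at h
      have hP := tprod_one_sub_pow_succ_ne_zero hp
      have hR := tprod_pair_ne_zero hq hu hv
      refine eq_inv_of_mul_eq_one_left ?_
      apply mul_left_cancel₀ (mul_ne_zero hP hR)
      linear_combination -h
  rw [← hF]
  exact (summable_rrSeries hq i).hasSum

theorem theorem1 :
    -- the two identities, for `q` an indeterminate or any field element for which the
    -- denominators `(q;q)_{n-r}`, `0 ≤ r ≤ n`, do not vanish
    (∀ (K : Type*) [Field K] (q : K) (k n : ℕ), (k = 0 ∨ k = 1) → qPoch q q n ≠ 0 →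
      partialTheta 1 q k n = weightedSum schurE q k n ∧
      partialTheta 3 q k n = weightedSum schurD q k n) ∧
    -- the limits `n → ∞` of the two sides of each identity, and the Rogers–Ramanujan identities
    (∀ q : ℂ, ‖q‖ < 1 →
      (Summable (thetaTerm 1 q) ∧ Summable (thetaTerm 3 q) ∧
        Multipliable (fun i : ℕ => 1 - q ^ (i + 1)) ∧
        ∀ k : ℕ, (k = 0 ∨ k = 1) →
          Tendsto (fun n => partialTheta 1 q k n) atTop (𝓝 (∑' j : ℤ, thetaTerm 1 q j)) ∧
          Tendsto (fun n => weightedSum schurE q k n) atTop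
            (𝓝 ((∏' i : ℕ, (1 - q ^ (i + 1))) * ∑' m : ℕ, q ^ (m ^ 2) / qPoch q q m)) ∧
          Tendsto (fun n => partialTheta 3 q k n) atTop (𝓝 (∑' j : ℤ, thetaTerm 3 q j)) ∧
          Tendsto (fun n => weightedSum schurD q k n) atTop
            (𝓝 ((∏' i : ℕ, (1 - q ^ (i + 1))) * ∑' m : ℕ, q ^ (m * (m + 1)) / qPoch q q m))) ∧
      (Multipliable (fun j : ℕ => 1 / ((1 - q ^ (5 * j + 1)) * (1 - q ^ (5 * j + 4)))) ∧
        HasSum (fun m : ℕ => q ^ (m ^ 2) / qPoch q q m)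
          (∏' j : ℕ, 1 / ((1 - q ^ (5 * j + 1)) * (1 - q ^ (5 * j + 4))))) ∧
      (Multipliable (fun j : ℕ => 1 / ((1 - q ^ (5 * j + 2)) * (1 - q ^ (5 * j + 3)))) ∧
        HasSum (fun m : ℕ => q ^ (m * (m + 1)) / qPoch q q m)
          (∏' j : ℕ, 1 / ((1 - q ^ (5 * j + 2)) * (1 - q ^ (5 * j + 3)))))) := by

  refine ⟨fun K _ q k n hk hn => partialTheta_eq_weightedSum q hk hn, fun q hq => ?_⟩
  have hid := fun n => partialTheta_eq_weightedSum q (.inl rfl) (qPoch_ne_zero hq n)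
  have h1 := (summable_norm_thetaTerm (c := 1) hq (by norm_num)).of_norm
  have h3 := (summable_norm_thetaTerm (c := 3) hq (by norm_num)).of_norm
  have hE : ∀ k, k = 0 ∨ k = 1 → Tendsto (fun n => weightedSum schurE q k n) atTop
      (𝓝 ((∏' i : ℕ, (1 - q ^ (i + 1))) * rrSeries q 0)) := fun k hk => by
    simpa using tendsto_weightedSum hq (aeval_schurE q) hk
  have hD : ∀ k, k = 0 ∨ k = 1 → Tendsto (fun n => weightedSum schurD q k n) atTop
      (𝓝 ((∏' i : ℕ, (1 - q ^ (i + 1))) * rrSeries q 1)) := fun k hk => by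
    simpa using tendsto_weightedSum hq (aeval_schurD q) hk
  have e0 : (fun m : ℕ => q ^ (m ^ 2) / qPoch q q m) =
      fun m => q ^ (m ^ 2 + 0 * m) / qPoch q q m := by simp
  have e1 : (fun m : ℕ => q ^ (m * (m + 1)) / qPoch q q m) =
      fun m => q ^ (m ^ 2 + 1 * m) / qPoch q q m := by
    funext m; ring_nf
  rw [e0, e1]
  refine ⟨⟨h1, h3, multipliable_one_sub_pow_succ hq, fun k hk => ⟨tendsto_partialTheta h1 k,
    hE k hk, tendsto_partialTheta h3 k, hD k hk⟩⟩, ?_, ?_⟩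
  -- Here c = 1 = 3 - 2: the theta product takes the residues 2, 3 modulo 5 and leaves 1, 4.
  · refine hasSum_rrSeries_of_eq (u := 3) (v := 2) hq rfl (by norm_num) (by norm_num) (by norm_num)
      (by norm_num) (by norm_num) (hE 0 (.inl rfl)) (fun n => (hid n).1) ?_
    rw [tprod_one_sub_pow_succ_eq hq]
    simp only [mul_comm (1 - q ^ (_ + 3))]
  · refine hasSum_rrSeries_of_eq (u := 4) (v := 1) hq rfl (by norm_num) (by norm_num) (by norm_num)
      (by norm_num) (by norm_num) (hD 0 (.inl rfl)) (fun n => (hid n).2) ?_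
    rw [tprod_one_sub_pow_succ_eq hq, mul_right_comm]
    simp only [mul_comm (1 - q ^ (_ + 4))]
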